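/- Let $n\ge 0$ and let $P\subseteq\mathbb{R}^n$ be an $n$-dimensional lattice simplex, i.e. the convex hull of affinely independent points $v_0,\dots,v_n\in\mathbb{Z}^n$. For a nonempty face $F$ of $P$ (the set where some linear functional attains its maximum over $P$; the zero functional gives $P$ itself) let $\operatorname{Vol}_{\mathbb{Z}}(F)$ be its normalized volume, i.e. the translation-invariant volume on the affine span $\operatorname{aff}(F)$, scaled so that a fundamental parallelepiped of the affine lattice $\operatorname{aff}(F)\cap\mathbb{Z}^n$ has volume $\dim(F)!$. Let $\mathcal{F}(P)_j$ be the set of $j$-dimensional faces of $P$, and put $$c(P):=\sum_{j=0}^n(-1)^{n-j}(j+1)\sum_{F\in\mathcal{F}(P)_j}\operatorname{Vol}_{\mathbb{Z}}(F).$$ For $I\subseteq\{0,\dots,n\}$ let $$s_I:=\Bigl|\Bigl\{x\in\mathbb{Z}^{n+1} : x=\sum_{i\in I}\lambda_i\,(v_i,1)\ \text{with } 0<\lambda_i<1 \text{ for all } i\in I\Bigr\}\Bigr|,$$ so that $s_\emptyset=1$. Then $$c(P)\ge 0,\qquad\text{and more precisely}\qquad c(P)=\sum_{I\subseteq\{0,\dots,n\}}\binom{|I|}{n}\,s_I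 .$$ In particular, Di Rocco's conjecture that $c(P)\ge 0$ for every $n$-dimensional lattice polytope $P\subset\mathbb{R}^n$ holds for simplices. -/

import Mathlib

open MeasureTheory

noncomputable section

namespace LatticePolytope

/-- The lattice `ℤⁿ` inside `ℝⁿ`. -/
def intLattice (n : ℕ) : Submodule ℤ (Fin n → ℝ) :=
  Submodule.span ℤ (Set.range (Pi.basisFun ℝ (Fin n)))

/-- The dimension of a (nonempty) set: the dimension of its affine span. -/
def dim {n : ℕ} (F : Set (Fin n → ℝ)) : ℕ :=
  Module.finrank ℝ (vectorSpan ℝ F)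

/-- The lattice of integer vectors parallel to the affine span of `F`. When the affine span of `F`
contains a lattice point `p`, one has `aff(F) ∩ ℤⁿ = p + latticeOf F`. -/
def latticeOf {n : ℕ} (F : Set (Fin n → ℝ)) : Submodule ℤ (vectorSpan ℝ F) :=
  ZLattice.comap ℝ (intLattice n) (vectorSpan ℝ F).subtype

/-- A set `F`, seen from one of its points `p` as a subset of the direction space of its affine
span. -/
def chart {n : ℕ} (F : Set (Fin n → ℝ)) (p : Fin n → ℝ) : Set (vectorSpan ℝ F) :=
  {w | p + (w : Fin n → ℝ) ∈ F}

open Classical in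
/-- The normalized volume `Vol_ℤ(F)`: the volume on the affine span of `F`, scaled so that a
fundamental parallelepiped of `aff(F) ∩ ℤⁿ` has volume `dim(F)!`. It is the quotient of the
Haar measure of `F` by that of a fundamental domain of the lattice, times `dim(F)!`; neither the
normalization of the Haar measure nor the base point matters. -/
def normalizedVolume {n : ℕ} (F : Set (Fin n → ℝ)) : ℝ :=
  if h : F.Nonempty then
    (Nat.factorial (dim F) : ℝ) *
      ((Measure.addHaar : Measure (vectorSpan ℝ F)).real (chart F h.some) /
        ZLattice.covolume (latticeOf F) Measure.addHaar)
  else 0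

/-- The normalized volume does not depend on the base point. -/
theorem normalizedVolume_eq {n : ℕ} (F : Set (Fin n → ℝ)) {p : Fin n → ℝ} (hp : p ∈ F) :
    normalizedVolume F = (Nat.factorial (dim F) : ℝ) *
      ((Measure.addHaar : Measure (vectorSpan ℝ F)).real (chart F p) /
        ZLattice.covolume (latticeOf F) Measure.addHaar) := by
  have h : F.Nonempty := ⟨p, hp⟩
  have hq := h.some_mem
  set q := h.some with hqdef
  let d : vectorSpan ℝ F := ⟨q - p, vsub_mem_vectorSpan ℝ hq hp⟩
  have hc : chart F q = (fun w => d + w) ⁻¹' chart F p := by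
    ext w
    simp only [chart, Set.mem_ofPred_eq, Set.mem_preimage, Submodule.coe_add, d]
    rw [show p + (q - p + (w : Fin n → ℝ)) = q + w by abel]
  rw [normalizedVolume, dif_pos h, ← hqdef, hc]
  simp only [Measure.real, measure_preimage_add]

/-- The set of `j`-dimensional (nonempty) faces of `P`: a face is the locus of `P` where some linear
functional attains its maximum over `P` (the zero functional gives `P` itself). -/
def faces {n : ℕ} (P : Set (Fin n → ℝ)) (j : ℕ) : Set (Set (Fin n → ℝ)) :=
  {F | IsExposed ℝ P F ∧ F.Nonempty ∧ dim F = j}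

/-- The invariant `c(P) = ∑_{j=0}^n (-1)^{n-j} (j+1) ∑_{F a j-dimensional face of P} Vol_ℤ(F)` of an
`n`-dimensional lattice polytope `P ⊆ ℝⁿ`. A polytope has finitely many faces, so that the inner
sum is a finite sum. -/
def c {n : ℕ} (P : Set (Fin n → ℝ)) : ℝ :=
  ∑ j ∈ Finset.range (n + 1),
    (-1 : ℝ) ^ (n - j) * ((j : ℝ) + 1) * ∑ᶠ F ∈ faces P j, normalizedVolume F

/-- A lattice point of `ℤᵐ`, as a point of `ℝᵐ`. -/
def toReal {m : ℕ} (x : Fin m → ℤ) : Fin m → ℝ := fun k => (x k : ℝ)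

/-- The point `(x, 1)` of `ℤⁿ⁺¹`, for `x ∈ ℤⁿ`. -/
def lift {n : ℕ} (x : Fin n → ℤ) : Fin (n + 1) → ℤ := Fin.snoc (α := fun _ => ℤ) x 1

/-- The number `s_I` of lattice points `x ∈ ℤⁿ⁺¹` of the form `x = ∑_{i ∈ I} lᵢ (vᵢ, 1)` with
`0 < lᵢ < 1` for all `i ∈ I`. For `I = ∅` it is `1`, the empty sum `0` being the only such point. -/
def s {n : ℕ} (v : Fin (n + 1) → Fin n → ℤ) (I : Finset (Fin (n + 1))) : ℕ :=
  Set.ncard {x : Fin (n + 1) → ℤ | ∃ l : Fin (n + 1) → ℝ,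
    (∀ i ∈ I, 0 < l i ∧ l i < 1) ∧ toReal x = ∑ i ∈ I, l i • toReal (lift (v i))}

end LatticePolytope

end

namespace LatticePolytope

open Module

variable {n : ℕ}

/-! The faces of a simplex correspond to the nonempty sets `J` of vertices (`faces_simplex`), so
`c(P)` is an alternating sum over `J` with weights `|J|`. The normalized volume of a face is the
index of its edge lattice in its full lattice (`normalizedVolume_simplexFace`): the `d!` of the
normalization cancels the volume ratio between a simplex and the parallelepiped on its edges.

This index counts the lattice points of the half-open box over `J`, which represent the cosets
(`card_quotient_eq_card_halfOpenBox`). Sorting these points by the support `I ⊆ J` of their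
coefficients gives `∑_{I ⊆ J} s_I` (`card_halfOpenBox`).

After exchanging sums, the coefficient of `s_I` is an alternating sum over the `J ⊇ I`, equal to
`|I|.choose n` (`sum_superset_neg_one_pow_mul_card`). All terms are nonnegative, hence so is `c(P)`.
-/

/-! ### Volumes of simplices and lattice indices -/

theorem volume_solidSimplex_fin (d : ℕ) (t : ℝ) (ht : 0 ≤ t) :
    volume {x : Fin d → ℝ | (∀ i, 0 ≤ x i) ∧ ∑ i, x i ≤ t} =
      ENNReal.ofReal (t ^ d / d.factorial) := by
  induction d generalizing t with
  | zero =>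
    rw [show {x : Fin 0 → ℝ | (∀ i, 0 ≤ x i) ∧ ∑ i, x i ≤ t} = Set.univ.pi fun _ => Set.Icc 0 1 by
      ext x; simp [ht], volume_pi_pi]
    simp
  | succ d ih =>
    have hm : MeasurableSet {x : Fin (d + 1) → ℝ | (∀ i, 0 ≤ x i) ∧ ∑ i, x i ≤ t} := by
      measurability
    rw [← (volume_preserving_piFinSuccAbove (fun _ => ℝ) (0 : Fin (d + 1))).symm.measure_preimage
      hm.nullMeasurableSet, Measure.volume_eq_prod, Measure.prod_apply
      ((MeasurableEquiv.measurable _) hm)]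
    -- The slice at first coordinate `a` is a solid simplex of size `t - a`, empty unless `0 ≤ a ≤
    -- t`; hence the induction over all `t`.
    have h : ∀ a : ℝ, volume (Prod.mk a ⁻¹'
        ((MeasurableEquiv.piFinSuccAbove (fun _ => ℝ) (0 : Fin (d + 1))).symm ⁻¹'
        {x : Fin (d + 1) → ℝ | (∀ i, 0 ≤ x i) ∧ ∑ i, x i ≤ t})) =
        (Set.Icc 0 t).indicator (fun a => ENNReal.ofReal ((t - a) ^ d / d.factorial)) a := by
      intro a
      have hs : (Prod.mk a ⁻¹'
        ((MeasurableEquiv.piFinSuccAbove (fun _ => ℝ) (0 : Fin (d + 1))).symm ⁻¹'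
        {x : Fin (d + 1) → ℝ | (∀ i, 0 ≤ x i) ∧ ∑ i, x i ≤ t})) =
          {x : Fin d → ℝ | 0 ≤ a ∧ (∀ i, 0 ≤ x i) ∧ ∑ i, x i ≤ t - a} := by
        ext x
        simp [MeasurableEquiv.piFinSuccAbove, Fin.forall_fin_succ, Fin.sum_univ_succ, and_assoc,
          le_sub_iff_add_le']
      rw [hs]
      by_cases ha : a ∈ Set.Icc 0 t
      · rw [Set.indicator_of_mem ha, ← ih (t - a) (by linarith [ha.2])]
        simp [ha.1]
      · rw [Set.indicator_of_notMem ha]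
        convert measure_empty (μ := volume)
        ext x
        simp only [Set.mem_ofPred_eq, Set.mem_empty_iff_false, iff_false]
        rintro ⟨h0, hx, hs⟩
        exact ha ⟨h0, by linarith [Finset.sum_nonneg fun i (_ : i ∈ Finset.univ) => hx i]⟩
    simp_rw [h]
    rw [lintegral_indicator measurableSet_Icc, ← ofReal_integral_eq_lintegral_ofReal]
    · congr 1
      rw [integral_Icc_eq_integral_Ioc, ← intervalIntegral.integral_of_le ht,
        intervalIntegral.integral_comp_sub_left (fun x => x ^ d / (d.factorial : ℝ))]
      simp only [sub_self, sub_zero, intervalIntegral.integral_div, integral_pow]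
      rw [Nat.factorial_succ]
      push_cast
      field_simp
      simp
    · exact (Continuous.integrableOn_Icc (by fun_prop))
    · refine (ae_restrict_iff' measurableSet_Icc).2 (.of_forall fun a ha => ?_)
      exact div_nonneg (pow_nonneg (by linarith [ha.2]) _) (by positivity)

/-- The volume of the standard solid simplex. -/
theorem volume_solidSimplex (ι : Type*) [Fintype ι] :
    volume {x : ι → ℝ | (∀ i, 0 ≤ x i) ∧ ∑ i, x i ≤ 1} =
      ENNReal.ofReal (1 / (Fintype.card ι).factorial) := by
  have hm : MeasurableSet {x : ι → ℝ | (∀ i, 0 ≤ x i) ∧ ∑ i, x i ≤ 1} := by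
    measurability
  let e := (Fintype.equivFin ι).symm
  rw [← (volume_measurePreserving_piCongrLeft (fun _ => ℝ) e).measure_preimage
    hm.nullMeasurableSet]
  have := volume_solidSimplex_fin (Fintype.card ι) 1 zero_le_one
  rw [one_pow] at this
  rw [← this]
  congr 1
  ext x
  have h1 : ∀ i, (MeasurableEquiv.piCongrLeft (fun _ => ℝ) e) x i = x (e.symm i) := fun i => by
    conv_lhs => rw [← e.apply_symm_apply i]
    exact Equiv.piCongrLeft_apply_apply (fun _ => ℝ) e x (e.symm i)
  simp only [Set.mem_preimage, Set.mem_ofPred_eq, h1]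
  rw [e.symm.forall_congr_left, Equiv.sum_comp e.symm]
  simp

/-- In coordinates with respect to a basis, the solid simplex has a `d!`-th of the volume of the
fundamental parallelepiped. -/
theorem measureReal_solidSimplex {E ι : Type*} [NormedAddCommGroup E] [NormedSpace ℝ E]
    [MeasurableSpace E] [BorelSpace E] [Fintype ι] (b : Module.Basis ι ℝ E)
    (μ : Measure E) [μ.IsAddHaarMeasure] :
    μ.real {w | (∀ i, 0 ≤ b.repr w i) ∧ ∑ i, b.repr w i ≤ 1} =
      μ.real (ZSpan.fundamentalDomain b) / (Fintype.card ι).factorial := by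
  have := b.finiteDimensional_of_finite
  let e : E ≃L[ℝ] (ι → ℝ) := b.equivFun.toContinuousLinearEquiv
  have he : ∀ w i, e w i = b.repr w i := fun w i => rfl
  have hA : (μ.map e).IsAddHaarMeasure := e.isAddHaarMeasure_map μ
  -- By uniqueness of Haar measure, coordinates turn `μ` into a multiple `k` of Lebesgue measure;
  -- the unit cube identifies `k` as the measure of the fundamental domain.
  have hc := Measure.isAddLeftInvariant_eq_smul (μ.map e) volume
  generalize Measure.addHaarScalarFactor (μ.map e) volume = k at hc
  have h : ∀ s : Set (ι → ℝ), MeasurableSet s → μ.real (e ⁻¹' s) = k * volume.real s := by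
    intro s hs
    rw [Measure.real, ← Measure.map_apply e.continuous.measurable hs, hc, Measure.smul_apply]
    exact ENNReal.toReal_smul k _
  have h1 := h {x | (∀ i, 0 ≤ x i) ∧ ∑ i, x i ≤ 1} (by measurability)
  have h2 := h (Set.univ.pi fun _ : ι => Set.Ico (0 : ℝ) 1)
    (MeasurableSet.univ_pi fun _ => measurableSet_Ico)
  rw [measureReal_def volume, volume_solidSimplex, ENNReal.toReal_ofReal (by positivity)] at h1
  rw [measureReal_def volume, volume_pi_pi] at h2
  simp only [Set.preimage, Set.mem_ofPred_eq, he] at h1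
  simp only [Set.preimage, Set.mem_pi, Set.mem_univ, true_implies, he, Real.volume_Ico, sub_zero,
    ENNReal.ofReal_one, Finset.prod_const_one, ENNReal.toReal_one] at h2
  rw [h1, show ZSpan.fundamentalDomain b = {w | ∀ i, b.repr w i ∈ Set.Ico (0 : ℝ) 1} from rfl, h2]
  ring

/-- The index of the lattice spanned by a basis, in a lattice containing it, as a quotient of
volumes. -/
theorem fundamentalDomain_div_covolume {E ι : Type*} [NormedAddCommGroup E] [NormedSpace ℝ E]
    [MeasurableSpace E] [BorelSpace E] [Fintype ι] (b : Module.Basis ι ℝ E)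
    (μ : Measure E) [μ.IsAddHaarMeasure] [FiniteDimensional ℝ E] (L : Submodule ℤ E)
    [DiscreteTopology L] [IsZLattice ℝ L] (hL : Submodule.span ℤ (Set.range b) ≤ L) :
    μ.real (ZSpan.fundamentalDomain b) / ZLattice.covolume L μ =
      (Nat.card (L ⧸ (Submodule.span ℤ (Set.range b)).comap L.subtype) : ℝ) := by
  classical
  have := ZLattice.module_free ℝ L
  have := ZLattice.module_finite ℝ L
  let b₀ := Module.Free.chooseBasis ℤ L
  let b₂ : Module.Basis ι ℤ L :=
    b₀.reindex (Fintype.equivOfCardEq (by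
      rw [← Module.finrank_eq_card_basis (b₀.ofZLatticeBasis ℝ), Module.finrank_eq_card_basis b]))
  -- Index and volume ratio are both the absolute value of one change-of-basis determinant, read
  -- over `ℤ` and over `ℝ`.
  have hdet : Nat.card (L ⧸ (Submodule.span ℤ (Set.range b)).comap L.subtype) =
      (b₂.det fun i => (⟨b i, hL (Submodule.subset_span ⟨i, rfl⟩)⟩ : L)).natAbs := by
    let bN := (b.restrictScalars ℤ).map (Submodule.comapSubtypeEquivOfLe hL).symm
    have h := Submodule.natAbs_det_basis_change b₂ _ bN
    rw [← h]
    congr 2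
    ext i
    simp [bN]
  have hpos : ZLattice.covolume L μ ≠ 0 := ZLattice.covolume_ne_zero L μ
  rw [ZLattice.covolume_eq_measure_fundamentalDomain L μ (ZLattice.isAddFundamentalDomain b₂ μ)]
    at hpos ⊢
  rw [ZSpan.measureReal_fundamentalDomain b μ (b₂.ofZLatticeBasis ℝ), mul_div_cancel_right₀ _ hpos,
    hdet, Nat.cast_natAbs, Int.cast_abs, Module.Basis.det_apply, Module.Basis.det_apply, Int.cast_det]
  congr 2
  ext i j
  rw [Matrix.map_apply, Module.Basis.toMatrix_apply, Module.Basis.toMatrix_apply]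
  rw [← b₂.ofZLatticeBasis_repr_apply ℝ L _ i]

/-! ### Alternating sums over subsets -/

/-- Absorption, `(k+1) C(m+1,k+1) = (m+1) C(m,k)`, reduces this to the alternating sum of row `m` of
Pascal's triangle, which vanishes unless `m = 0`. -/
theorem sum_powerset_neg_one_pow_card_mul {α : Type*} [DecidableEq α] (S : Finset α) :
    ∑ K ∈ S.powerset, (-1 : ℝ) ^ K.card * K.card = if S.card = 1 then -1 else 0 := by
  rw [Finset.sum_powerset_apply_card (fun k => (-1 : ℝ) ^ k * k)]
  generalize S.card = m
  cases m with
  | zero => simp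
  | succ m =>
    rw [Finset.sum_range_succ']
    have h := congrArg (fun z : ℤ => (z : ℝ)) (Int.alternating_sum_range_choose (n := m))
    push_cast at h
    have h2 : ∀ k ∈ Finset.range (m + 1),
        (m + 1).choose (k + 1) • ((-1 : ℝ) ^ (k + 1) * ((k + 1 : ℕ) : ℝ)) =
          -(m + 1) * ((-1) ^ k * (m.choose k : ℝ)) := by
      intro k _
      have h3 : ((m : ℝ) + 1) * m.choose k = (m + 1).choose (k + 1) * (k + 1) := by
        exact_mod_cast Nat.add_one_mul_choose_eq m k
      rw [nsmul_eq_mul, pow_succ]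
      push_cast
      linear_combination (-1 : ℝ) * (-1) ^ k * -h3
    rw [Finset.sum_congr rfl h2, ← Finset.mul_sum, h]
    by_cases hm : m = 0 <;> simp [hm]

/-- Passing to complements `K ⊆ Iᶜ` turns the weight into `n + 1 - |K|`. The constant part survives
only for `Iᶜ = ∅`, giving `n + 1`; the part in `|K|` only for `|Iᶜ| = 1`, giving `1`. -/
theorem sum_superset_neg_one_pow_mul_card (I : Finset (Fin (n + 1))) :
    ∑ J : Finset (Fin (n + 1)), (if I ⊆ J then (-1 : ℝ) ^ (n + 1 - J.card) * J.card else 0) =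
      (I.card.choose n : ℝ) := by
  have hc : ∀ K : Finset (Fin (n + 1)), (Kᶜ.card : ℝ) = n + 1 - K.card := fun K => by
    rw [Finset.card_compl, Nat.cast_sub (Finset.card_le_univ K)]
    simp
  have h1 : ∑ J : Finset (Fin (n + 1)), (if I ⊆ J then (-1 : ℝ) ^ (n + 1 - J.card) * J.card else 0) =
      ∑ K ∈ Iᶜ.powerset, ((n + 1) * (-1 : ℝ) ^ K.card - (-1 : ℝ) ^ K.card * K.card) := by
    rw [← Finset.sum_filter]
    refine Finset.sum_nbij' (fun J => Jᶜ) (fun K => Kᶜ) ?_ ?_ (by simp) (by simp) ?_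
    · intro J hJ
      simpa using hJ
    · intro K hK
      simpa [Finset.subset_compl_comm] using hK
    · intro J hJ
      rw [hc J, Finset.card_compl, Fintype.card_fin]
      ring
  rw [h1, Finset.sum_sub_distrib, ← Finset.mul_sum, sum_powerset_neg_one_pow_card_mul]
  have h2 := congrArg (fun z : ℤ => (z : ℝ)) (Finset.sum_powerset_neg_one_pow_card (x := Iᶜ))
  push_cast at h2
  rw [h2]
  have hI : I.card ≤ n + 1 := by simpa using Finset.card_le_univ I
  have hIc : Iᶜ.card = n + 1 - I.card := by simp [Finset.card_compl]
  have he : Iᶜ = ∅ ↔ I.card = n + 1 := by rw [← Finset.card_eq_zero, hIc]; omega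
  rw [hIc]
  simp only [he]
  rcases Nat.lt_or_ge I.card n with h | h
  · rw [Nat.choose_eq_zero_of_lt h, if_neg (by omega), if_neg (by omega)]
    simp
  · obtain h | h : I.card = n ∨ I.card = n + 1 := by omega
    · simp [h]
    · simp [h]

/-! ### Faces of a simplex -/

/-- The face of a simplex spanned by a set of its vertices. -/
def simplexFace (B : AffineBasis (Fin (n + 1)) ℝ (Fin n → ℝ)) (J : Finset (Fin (n + 1))) :
    Set (Fin n → ℝ) :=
  convexHull ℝ (B '' J)

theorem mem_simplexFace {B : AffineBasis (Fin (n + 1)) ℝ (Fin n → ℝ)}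
    {J : Finset (Fin (n + 1))} {x : Fin n → ℝ} :
    x ∈ simplexFace B J ↔ (∀ i, 0 ≤ B.coord i x) ∧ ∀ i ∉ J, B.coord i x = 0 := by
  constructor
  · intro hx
    have hconv : Convex ℝ {x : Fin n → ℝ | (∀ i, 0 ≤ B.coord i x) ∧ ∀ i ∉ J, B.coord i x = 0} := by
      intro y hy z hz s t hs ht hst
      refine ⟨fun i => ?_, fun i hi => ?_⟩
      · rw [Convex.combo_affine_apply hst]
        exact add_nonneg (smul_nonneg hs (hy.1 i)) (smul_nonneg ht (hz.1 i))
      · rw [Convex.combo_affine_apply hst, hy.2 i hi, hz.2 i hi]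
        simp
    refine convexHull_min ?_ hconv hx
    rintro _ ⟨k, hk, rfl⟩
    refine ⟨fun i => ?_, fun i hi => B.coord_apply_ne ?_⟩
    · rw [B.coord_apply]
      split_ifs <;> norm_num
    · rintro rfl
      exact hi hk
  · rintro ⟨h0, h1⟩
    have hsub : ∀ f : Fin (n + 1) → ℝ, ∑ i ∈ J, B.coord i x * f i = ∑ i, B.coord i x * f i :=
      fun f => Finset.sum_subset (Finset.subset_univ J) fun i _ hi => by rw [h1 i hi, zero_mul]
    have hs : ∑ i ∈ J, B.coord i x = 1 := by
      simpa using (hsub fun _ => 1).trans (by simp)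
    have hx : ∑ i ∈ J, B.coord i x • B i = x := by
      conv_rhs => rw [← B.linear_combination_coord_eq_self x]
      exact Finset.sum_subset (Finset.subset_univ J) fun i _ hi => by rw [h1 i hi, zero_smul]
    rw [← hx]
    exact (convex_convexHull ℝ _).sum_mem (fun i _ => h0 i) hs fun i hi =>
      subset_convexHull ℝ _ ⟨i, hi, rfl⟩

theorem vertex_mem_simplexFace {B : AffineBasis (Fin (n + 1)) ℝ (Fin n → ℝ)}
    {J : Finset (Fin (n + 1))} {i : Fin (n + 1)} : B i ∈ simplexFace B J ↔ i ∈ J := by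
  refine ⟨fun h => ?_, fun h => subset_convexHull ℝ _ ⟨i, h, rfl⟩⟩
  by_contra hi
  simpa using (mem_simplexFace.1 h).2 i hi

theorem simplexFace_injective (B : AffineBasis (Fin (n + 1)) ℝ (Fin n → ℝ)) :
    Function.Injective (simplexFace B) := by
  intro J K h
  ext i
  rw [← vertex_mem_simplexFace (B := B), h, vertex_mem_simplexFace]

theorem vectorSpan_simplexFace (B : AffineBasis (Fin (n + 1)) ℝ (Fin n → ℝ))
    (J : Finset (Fin (n + 1))) : vectorSpan ℝ (simplexFace B J) = vectorSpan ℝ (B '' J) := by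
  rw [← direction_affineSpan, simplexFace, affineSpan_convexHull, direction_affineSpan]

theorem dim_simplexFace (B : AffineBasis (Fin (n + 1)) ℝ (Fin n → ℝ))
    {J : Finset (Fin (n + 1))} {j : ℕ} (hJ : J.card = j + 1) : dim (simplexFace B J) = j := by
  classical
  rw [dim, vectorSpan_simplexFace, ← Finset.coe_image]
  exact B.ind.finrank_vectorSpan_image_finset hJ

/-- A functional exposes the face spanned by the vertices at which it is maximal. -/
theorem exposed_eq_simplexFace (B : AffineBasis (Fin (n + 1)) ℝ (Fin n → ℝ))
    {F : Set (Fin n → ℝ)} (hF : IsExposed ℝ (convexHull ℝ (Set.range B)) F) (hne : F.Nonempty) :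
    ∃ J : Finset (Fin (n + 1)), J.Nonempty ∧ F = simplexFace B J := by
  classical
  obtain ⟨l, rfl⟩ := hF hne
  obtain ⟨k, -, hk⟩ := Finset.exists_max_image Finset.univ (fun i => l (B i))
    Finset.univ_nonempty
  have hl : ∀ x, l x = ∑ i, B.coord i x * l (B i) := fun x => by
    conv_lhs => rw [← B.linear_combination_coord_eq_self x]
    simp only [map_sum, map_smul, smul_eq_mul]
  have hP : convexHull ℝ (Set.range B) = {x | ∀ i, 0 ≤ B.coord i x} :=
    B.convexHull_eq_nonneg_coord
  -- On `P` every summand is nonnegative, so `x` is maximal exactly when its coordinates vanish at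
  -- all non-maximal vertices.
  have hdiff : ∀ x, l (B k) - l x = ∑ i, B.coord i x * (l (B k) - l (B i)) := fun x => by
    rw [hl x]
    simp only [mul_sub, Finset.sum_sub_distrib, ← Finset.sum_mul, B.sum_coord_apply_eq_one, one_mul]
  refine ⟨Finset.univ.filter fun i => l (B i) = l (B k), ⟨k, by simp⟩, ?_⟩
  have hnn : ∀ x ∈ convexHull ℝ (Set.range B), ∀ i ∈ Finset.univ,
      0 ≤ B.coord i x * (l (B k) - l (B i)) := fun x hx i hi => by
    rw [hP] at hx
    exact mul_nonneg (hx i) (sub_nonneg.2 (hk i hi))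
  ext x
  rw [mem_simplexFace]
  constructor
  · rintro ⟨hx, hmax⟩
    have h0 : l (B k) ≤ l x := hmax _ (subset_convexHull ℝ _ ⟨k, rfl⟩)
    have h1 := hdiff x
    have h2 := Finset.sum_nonneg (hnn x hx)
    have h3 := (Finset.sum_eq_zero_iff_of_nonneg (hnn x hx)).1 (by linarith)
    refine ⟨by rwa [hP] at hx, fun i hi => ?_⟩
    have h4 := h3 i (Finset.mem_univ i)
    rcases mul_eq_zero.1 h4 with h | h
    · exact h
    · exact absurd (by simp; linarith) hi
  · rintro ⟨hx, h0⟩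
    have hx' : x ∈ convexHull ℝ (Set.range B) := by rwa [hP]
    refine ⟨hx', fun y hy => ?_⟩
    have h1 := hdiff y
    have h2 := Finset.sum_nonneg (hnn y hy)
    have h3 := hdiff x
    rw [Finset.sum_eq_zero fun i _ => ?_] at h3
    · linarith
    · by_cases hi : l (B i) = l (B k)
      · simp [hi]
      · rw [h0 i (by simpa using hi), zero_mul]

theorem isExposed_simplexFace (B : AffineBasis (Fin (n + 1)) ℝ (Fin n → ℝ))
    {J : Finset (Fin (n + 1))} (hJ : J.Nonempty) :
    IsExposed ℝ (convexHull ℝ (Set.range B)) (simplexFace B J) := by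
  classical
  intro _
  obtain ⟨k, hk⟩ := hJ
  have hP : convexHull ℝ (Set.range B) = {x | ∀ i, 0 ≤ B.coord i x} :=
    B.convexHull_eq_nonneg_coord
  -- Up to a constant this is minus the total barycentric weight outside `J`, which on `P` is
  -- maximal exactly where that weight is zero.
  let l : (Fin n → ℝ) →ₗ[ℝ] ℝ := -∑ i ∈ Jᶜ, (B.coord i).linear
  have hl : ∀ x, l x - l (B k) = -∑ i ∈ Jᶜ, B.coord i x := fun x => by
    have h : ∀ i ∈ Jᶜ, (B.coord i).linear (x - B k) = B.coord i x := fun i hi => by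
      have h1 := (B.coord i).linearMap_vsub x (B k)
      rw [B.coord_apply_ne (by rintro rfl; simp at hi; contradiction)] at h1
      simpa using h1
    rw [← map_sub]
    simp only [l, LinearMap.neg_apply, LinearMap.sum_apply]
    rw [Finset.sum_congr rfl h]
  refine ⟨LinearMap.toContinuousLinearMap l, ?_⟩
  ext x
  simp only [Set.mem_ofPred_eq, LinearMap.coe_toContinuousLinearMap', hP, mem_simplexFace]
  refine and_congr_right fun hx => ⟨fun h0 y hy => ?_, fun hmax => ?_⟩
  · have h1 := hl x
    rw [Finset.sum_eq_zero fun i hi => h0 i (by simpa using hi)] at h1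
    have h2 := hl y
    have h3 := Finset.sum_nonneg fun i (_ : i ∈ Jᶜ) => hy i
    linarith
  · have h1 := hmax (B k) fun i => by rw [B.coord_apply]; split_ifs <;> norm_num
    have h2 := hl x
    have h3 := Finset.sum_nonneg fun i (_ : i ∈ Jᶜ) => hx i
    have h4 := (Finset.sum_eq_zero_iff_of_nonneg fun i (_ : i ∈ Jᶜ) => hx i).1 (by linarith)
    exact fun i hi => h4 i (by simpa using hi)

theorem faces_simplex (B : AffineBasis (Fin (n + 1)) ℝ (Fin n → ℝ)) (j : ℕ) :
    faces (convexHull ℝ (Set.range B)) j =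
      simplexFace B '' {J : Finset (Fin (n + 1)) | J.card = j + 1} := by
  ext F
  constructor
  · rintro ⟨hF, hne, hd⟩
    obtain ⟨J, hJ, rfl⟩ := exposed_eq_simplexFace B hF hne
    obtain ⟨d, hd'⟩ := Nat.exists_eq_succ_of_ne_zero hJ.card_ne_zero
    refine ⟨J, ?_, rfl⟩
    rw [dim_simplexFace B hd'] at hd
    rw [Set.mem_ofPred_eq, hd', hd]
  · rintro ⟨J, hJ, rfl⟩
    have hne : J.Nonempty := Finset.card_pos.1 (by rw [hJ]; omega)
    obtain ⟨k, hk⟩ := hne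
    exact ⟨isExposed_simplexFace B ⟨k, hk⟩, ⟨B k, vertex_mem_simplexFace.2 hk⟩,
      dim_simplexFace B hJ⟩

theorem c_simplex (B : AffineBasis (Fin (n + 1)) ℝ (Fin n → ℝ)) :
    c (convexHull ℝ (Set.range B)) = ∑ J : Finset (Fin (n + 1)),
      (-1 : ℝ) ^ (n + 1 - J.card) * J.card * normalizedVolume (simplexFace B J) := by
  classical
  have h : ∀ j, ∑ᶠ F ∈ faces (convexHull ℝ (Set.range B)) j, normalizedVolume F =
      ∑ J : Finset (Fin (n + 1)) with J.card = j + 1, normalizedVolume (simplexFace B J) := by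
    intro j
    rw [faces_simplex, finsum_mem_image (simplexFace_injective B).injOn,
      ← finsum_mem_coe_finset]
    simp
  have hm : ∀ J ∈ (Finset.univ : Finset (Finset (Fin (n + 1)))),
      J.card ∈ Finset.range (n + 2) := fun J _ => by
    have := Finset.card_le_univ J
    rw [Fintype.card_fin] at this
    exact Finset.mem_range.2 (by omega)
  rw [← Finset.sum_fiberwise_of_maps_to hm, Finset.sum_range_succ', c]
  -- The empty set is not a face, but its weight `|J| = 0` allows summing over all `J`.
  rw [Finset.sum_eq_zero (s := Finset.univ.filter fun J : Finset (Fin (n + 1)) => J.card = 0)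
    fun J hJ => by rw [(Finset.mem_filter.1 hJ).2]; simp, add_zero]
  refine Finset.sum_congr rfl fun j _ => ?_
  rw [h, Finset.mul_sum]
  refine Finset.sum_congr rfl fun J hJ => ?_
  rw [(Finset.mem_filter.1 hJ).2, Nat.add_sub_add_right]
  push_cast
  ring

/-! ### Normalized volume of a face as an index -/

/-- The edges of a face of a simplex emanating from one of its vertices `k`, as a basis of the
direction space of the face. -/
noncomputable def edgeBasis (B : AffineBasis (Fin (n + 1)) ℝ (Fin n → ℝ))
    {J : Finset (Fin (n + 1))} {k : Fin (n + 1)} (hk : k ∈ J) :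
    Basis (J.erase k) ℝ (vectorSpan ℝ (simplexFace B J)) :=
  have hli : LinearIndependent ℝ fun i : J.erase k =>
      (⟨B i - B k, vsub_mem_vectorSpan ℝ
        (vertex_mem_simplexFace.2 (Finset.mem_of_mem_erase i.2)) (vertex_mem_simplexFace.2 hk)⟩ :
        vectorSpan ℝ (simplexFace B J)) := by
    refine LinearIndependent.of_comp (vectorSpan ℝ (simplexFace B J)).subtype ?_
    have h := (affineIndependent_iff_linearIndependent_vsub ℝ _ k).1 B.ind
    exact h.comp (fun i : J.erase k => ⟨i, Finset.ne_of_mem_erase i.2⟩) fun i j hij =>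
      Subtype.ext (congrArg (fun x : {x // x ≠ k} => x.1) hij)
  Basis.mk hli (hli.span_eq_top_of_card_eq_finrank' (by
    have hd := dim_simplexFace B (J := J) (j := J.card - 1)
      (Nat.sub_add_cancel (Finset.card_pos.2 ⟨k, hk⟩)).symm
    rw [dim] at hd
    rw [hd, Fintype.card_coe, Finset.card_erase_of_mem hk])).ge

theorem coe_edgeBasis (B : AffineBasis (Fin (n + 1)) ℝ (Fin n → ℝ))
    {J : Finset (Fin (n + 1))} {k : Fin (n + 1)} (hk : k ∈ J) (i : J.erase k) :
    (edgeBasis B hk i : Fin n → ℝ) = B i - B k := by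
  rw [edgeBasis, Basis.mk_apply]

theorem coord_add_edge (B : AffineBasis (Fin (n + 1)) ℝ (Fin n → ℝ))
    {J : Finset (Fin (n + 1))} {k : Fin (n + 1)} (hk : k ∈ J)
    (w : vectorSpan ℝ (simplexFace B J)) (j : Fin (n + 1)) :
    B.coord j (B k + w) = B.coord j (B k) +
      ∑ i, (edgeBasis B hk).repr w i * (B.coord j (B i) - B.coord j (B k)) := by
  have hw : (w : Fin n → ℝ) = ∑ i, (edgeBasis B hk).repr w i • (B i - B k) := by
    conv_lhs => rw [← (edgeBasis B hk).sum_repr w]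
    rw [Submodule.coe_sum]
    refine Finset.sum_congr rfl fun i _ => ?_
    rw [Submodule.coe_smul, coe_edgeBasis]
  have h1 := (B.coord j).map_vadd (B k) w
  rw [vadd_eq_add, vadd_eq_add, add_comm (w : Fin n → ℝ)] at h1
  rw [h1, add_comm ((B.coord j).linear w)]
  congr 1
  conv_lhs => rw [hw]
  rw [map_sum]
  refine Finset.sum_congr rfl fun i _ => ?_
  rw [map_smul, smul_eq_mul, ← vsub_eq_sub (B i), (B.coord j).linearMap_vsub, vsub_eq_sub]

/-- Seen from `B k`, the edge coordinates are the barycentric ones at `J.erase k`; the one at `k` is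
one minus their sum, and those outside `J` vanish. -/
theorem chart_simplexFace (B : AffineBasis (Fin (n + 1)) ℝ (Fin n → ℝ))
    {J : Finset (Fin (n + 1))} {k : Fin (n + 1)} (hk : k ∈ J) :
    chart (simplexFace B J) (B k) = {w | (∀ i, 0 ≤ (edgeBasis B hk).repr w i) ∧
      ∑ i, (edgeBasis B hk).repr w i ≤ 1} := by
  ext w
  have hin : ∀ j : J.erase k, B.coord j (B k + w) = (edgeBasis B hk).repr w j := by
    intro j
    have hj := Finset.ne_of_mem_erase j.2
    rw [coord_add_edge B hk, B.coord_apply_ne hj, Finset.sum_eq_single j]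
    · simp
    · intro i _ hij
      rw [B.coord_apply_ne fun h => hij (Subtype.ext h.symm)]
      simp
    · simp
  have hkk : B.coord k (B k + w) = 1 - ∑ i, (edgeBasis B hk).repr w i := by
    rw [coord_add_edge B hk, B.coord_apply_eq, sub_eq_add_neg, ← Finset.sum_neg_distrib]
    congr 1
    refine Finset.sum_congr rfl fun i _ => ?_
    rw [B.coord_apply_ne (Finset.ne_of_mem_erase i.2).symm]
    ring
  have hout : ∀ j ∉ J, B.coord j (B k + w) = 0 := by
    intro j hj
    rw [coord_add_edge B hk, B.coord_apply_ne (by rintro rfl; exact hj hk), zero_add]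
    refine Finset.sum_eq_zero fun i _ => ?_
    rw [B.coord_apply_ne]
    · simp
    · rintro rfl
      exact hj (Finset.mem_of_mem_erase i.2)
  simp only [chart, Set.mem_ofPred_eq, mem_simplexFace]
  constructor
  · rintro ⟨h, -⟩
    refine ⟨fun i => (hin i).symm ▸ h i, ?_⟩
    have := h k
    linarith
  · rintro ⟨h, hs⟩
    refine ⟨fun j => ?_, hout⟩
    by_cases hj : j ∈ J
    · by_cases hjk : j = k
      · subst hjk
        linarith
      · have := hin ⟨j, Finset.mem_erase.2 ⟨hjk, hj⟩⟩
        rw [this]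
        exact h _
    · rw [hout j hj]

theorem mem_intLattice {x : Fin n → ℝ} : x ∈ intLattice n ↔ ∃ a : Fin n → ℤ, toReal a = x := by
  rw [intLattice, Basis.mem_span_iff_repr_mem]
  constructor
  · intro h
    choose a ha using h
    exact ⟨a, funext fun i => by simpa [toReal] using ha i⟩
  · rintro ⟨a, rfl⟩ i
    exact ⟨a i, by simp [toReal]⟩

theorem mem_latticeOf {F : Set (Fin n → ℝ)} {w : vectorSpan ℝ F} :
    w ∈ latticeOf F ↔ ∃ a : Fin n → ℤ, toReal a = w :=
  mem_intLattice

theorem span_edgeBasis_le {B : AffineBasis (Fin (n + 1)) ℝ (Fin n → ℝ)}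
    {v : Fin (n + 1) → Fin n → ℤ} (hB : ∀ i, B i = toReal (v i))
    {J : Finset (Fin (n + 1))} {k : Fin (n + 1)} (hk : k ∈ J) :
    Submodule.span ℤ (Set.range (edgeBasis B hk)) ≤ latticeOf (simplexFace B J) := by
  rw [Submodule.span_le]
  rintro _ ⟨i, rfl⟩
  refine mem_latticeOf.2 ⟨v i - v k, ?_⟩
  rw [coe_edgeBasis, hB, hB]
  ext
  simp [toReal]

instance discreteTopology_latticeOf (F : Set (Fin n → ℝ)) : DiscreteTopology (latticeOf F) := by
  have : DiscreteTopology (intLattice n) :=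
    inferInstanceAs (DiscreteTopology (Submodule.span ℤ (Set.range (Pi.basisFun ℝ (Fin n)))))
  exact ZLattice.comap_discreteTopology ℝ _ continuous_subtype_val Subtype.val_injective

/-- The normalized volume of a lattice simplex is the index of the lattice generated by its
edges. -/
theorem normalizedVolume_simplexFace {B : AffineBasis (Fin (n + 1)) ℝ (Fin n → ℝ)}
    {v : Fin (n + 1) → Fin n → ℤ} (hB : ∀ i, B i = toReal (v i))
    {J : Finset (Fin (n + 1))} {k : Fin (n + 1)} (hk : k ∈ J) :
    normalizedVolume (simplexFace B J) = Nat.card (latticeOf (simplexFace B J) ⧸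
      (Submodule.span ℤ (Set.range (edgeBasis B hk))).comap
        (latticeOf (simplexFace B J)).subtype) := by
  have hle := span_edgeBasis_le hB hk
  have : IsZLattice ℝ (latticeOf (simplexFace B J)) := ⟨by
    rw [eq_top_iff, ← (edgeBasis B hk).span_eq]
    exact Submodule.span_mono (Submodule.subset_span.trans hle)⟩
  rw [normalizedVolume_eq _ (vertex_mem_simplexFace.2 hk), chart_simplexFace B hk,
    measureReal_solidSimplex, ← fundamentalDomain_div_covolume _ Measure.addHaar _ hle]
  have hd : dim (simplexFace B J) = Fintype.card (J.erase k) :=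
    Module.finrank_eq_card_basis (edgeBasis B hk)
  rw [hd]
  field_simp

/-! ### Lattice points of boxes -/

/-- The lattice points of the open parallelepiped spanned by the `(vᵢ, 1)`, `i ∈ I`. -/
def openBox (v : Fin (n + 1) → Fin n → ℤ) (I : Finset (Fin (n + 1))) : Set (Fin (n + 1) → ℤ) :=
  {x | ∃ l : Fin (n + 1) → ℝ,
    (∀ i ∈ I, 0 < l i ∧ l i < 1) ∧ toReal x = ∑ i ∈ I, l i • toReal (lift (v i))}

/-- The lattice points of the half-open parallelepiped spanned by the `(vᵢ, 1)`, `i ∈ J`. -/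
def halfOpenBox (v : Fin (n + 1) → Fin n → ℤ) (J : Finset (Fin (n + 1))) :
    Set (Fin (n + 1) → ℤ) :=
  {x | ∃ l : Fin (n + 1) → ℝ,
    (∀ i ∈ J, 0 ≤ l i ∧ l i < 1) ∧ toReal x = ∑ i ∈ J, l i • toReal (lift (v i))}

theorem toReal_eq_sum_lift_iff {v : Fin (n + 1) → Fin n → ℤ} {J : Finset (Fin (n + 1))}
    {l : Fin (n + 1) → ℝ} {x : Fin (n + 1) → ℤ} :
    toReal x = ∑ i ∈ J, l i • toReal (lift (v i)) ↔
      (toReal fun j => x (Fin.castSucc j)) = ∑ i ∈ J, l i • toReal (v i) ∧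
        (x (Fin.last n) : ℝ) = ∑ i ∈ J, l i := by
  simp only [funext_iff, Fin.forall_fin_succ', Finset.sum_apply, Pi.smul_apply, toReal, lift,
    Fin.snoc_castSucc, Fin.snoc_last, smul_eq_mul, Int.cast_one, mul_one]

theorem toReal_injective {m : ℕ} : Function.Injective (toReal (m := m)) := fun x y h =>
  funext fun i => by simpa [toReal] using congrFun h i

/-- Affine independence of the `vᵢ` amounts to linear independence of the `(vᵢ, 1)`. -/
theorem eqOn_of_sum_lift_eq {v : Fin (n + 1) → Fin n → ℤ}
    (hv : AffineIndependent ℝ fun i => toReal (v i)) {x : Fin (n + 1) → ℤ}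
    {J : Finset (Fin (n + 1))} {l m : Fin (n + 1) → ℝ}
    (hl : toReal x = ∑ i ∈ J, l i • toReal (lift (v i)))
    (hm : toReal x = ∑ i ∈ J, m i • toReal (lift (v i))) : ∀ i ∈ J, l i = m i := by
  rw [toReal_eq_sum_lift_iff] at hl hm
  intro i hi
  refine sub_eq_zero.1 ((affineIndependent_iff.1 hv) J (fun i => l i - m i) ?_ ?_ i hi)
  · rw [Finset.sum_sub_distrib, ← hl.2, ← hm.2, sub_self]
  · simp only [sub_smul]
    rw [Finset.sum_sub_distrib, ← hl.1, ← hm.1, sub_self]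

/-- Needed because `Set.ncard` and `Nat.card` are zero on infinite sets. -/
theorem finite_halfOpenBox (v : Fin (n + 1) → Fin n → ℤ) (J : Finset (Fin (n + 1))) :
    (halfOpenBox v J).Finite := by
  refine (Set.finite_Icc (fun j => -∑ i ∈ J, |lift (v i) j|)
    fun j => ∑ i ∈ J, |lift (v i) j|).subset ?_
  rintro x ⟨l, hl, hx⟩
  have h : ∀ j, |x j| ≤ ∑ i ∈ J, |lift (v i) j| := by
    intro j
    have hj : (x j : ℝ) = ∑ i ∈ J, l i * lift (v i) j := by
      simpa [toReal] using congrFun hx j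
    rw [← Int.cast_le (R := ℝ)]
    push_cast
    rw [hj]
    refine (Finset.abs_sum_le_sum_abs _ _).trans (Finset.sum_le_sum fun i hi => ?_)
    rw [abs_mul, abs_of_nonneg (hl i hi).1]
    exact mul_le_of_le_one_left (abs_nonneg _) (hl i hi).2.le
  exact ⟨fun j => (abs_le.1 (h j)).1, fun j => (abs_le.1 (h j)).2⟩

theorem openBox_subset {v : Fin (n + 1) → Fin n → ℤ} {I J : Finset (Fin (n + 1))} (h : I ⊆ J) :
    openBox v I ⊆ halfOpenBox v J := by
  classical
  rintro x ⟨l, hl, hx⟩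
  refine ⟨fun i => if i ∈ I then l i else 0, fun i _ => ?_, ?_⟩
  · by_cases hi : i ∈ I
    · simpa [hi] using ⟨(hl i hi).1.le, (hl i hi).2⟩
    · simp [hi]
  · simp only [ite_smul, zero_smul]
    rw [hx, ← Finset.sum_filter, Finset.filter_mem_eq_inter, Finset.inter_eq_right.2 h]

theorem exists_mem_openBox {v : Fin (n + 1) → Fin n → ℤ} {J : Finset (Fin (n + 1))}
    {x : Fin (n + 1) → ℤ} (hx : x ∈ halfOpenBox v J) : ∃ I ⊆ J, x ∈ openBox v I := by
  classical
  obtain ⟨l, hl, hx⟩ := hx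
  refine ⟨J.filter fun i => l i ≠ 0, Finset.filter_subset _ _, l, fun i hi => ?_, ?_⟩
  · rw [Finset.mem_filter] at hi
    exact ⟨lt_of_le_of_ne (hl i hi.1).1 hi.2.symm, (hl i hi.1).2⟩
  · rw [hx, Finset.sum_filter_of_ne]
    intro i _ h h0
    exact h (by rw [h0, zero_smul])

theorem subset_of_mem_openBox {v : Fin (n + 1) → Fin n → ℤ}
    (hv : AffineIndependent ℝ fun i => toReal (v i)) {I I' : Finset (Fin (n + 1))}
    {x : Fin (n + 1) → ℤ} (h : x ∈ openBox v I) (h' : x ∈ openBox v I') : I ⊆ I' := by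
  classical
  obtain ⟨l, hl, hx⟩ := h
  obtain ⟨l', hl', hx'⟩ := h'
  have he := eqOn_of_sum_lift_eq hv (J := Finset.univ) (x := x)
    (l := fun i => if i ∈ I then l i else 0) (m := fun i => if i ∈ I' then l' i else 0)
    (by simpa [ite_smul] using hx) (by simpa [ite_smul] using hx')
  intro i hi
  by_contra hi'
  have := he i (Finset.mem_univ i)
  simp only [hi, hi', if_true, if_false] at this
  exact (hl i hi).1.ne' this

/-- The half-open box is the disjoint union of the open boxes over `I ⊆ J`, where `I` is the support
of the coefficients, unique by affine independence. -/
theorem card_halfOpenBox {v : Fin (n + 1) → Fin n → ℤ}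
    (hv : AffineIndependent ℝ fun i => toReal (v i)) (J : Finset (Fin (n + 1))) :
    Nat.card (halfOpenBox v J) = ∑ I ∈ J.powerset, s v I := by
  classical
  have hf : ∀ I, (openBox v I).Finite := fun I =>
    (finite_halfOpenBox v I).subset (openBox_subset subset_rfl)
  have hs : ∀ I, s v I = (hf I).toFinset.card := fun I =>
    Set.ncard_eq_toFinset_card _ (hf I)
  simp only [hs]
  rw [← Finset.card_biUnion, Nat.card_coe_set_eq, ← Set.ncard_coe_finset]
  · congr 1
    ext x
    simp only [Finset.coe_biUnion, Set.mem_iUnion, Set.Finite.coe_toFinset, Finset.mem_coe,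
      Finset.mem_powerset, exists_prop]
    exact ⟨exists_mem_openBox, fun ⟨I, hI, hx⟩ => openBox_subset hI hx⟩
  · intro I _ I' _ hne
    rw [Function.onFun, Finset.disjoint_left]
    intro x hx hx'
    rw [Set.Finite.mem_toFinset] at hx hx'
    exact hne ((subset_of_mem_openBox hv hx hx').antisymm (subset_of_mem_openBox hv hx' hx))

/-! ### Box points as coset representatives -/

/-- The projection of a lattice point along `(vₖ, 1)` to height zero. -/
def project (v : Fin (n + 1) → Fin n → ℤ) (k : Fin (n + 1)) (x : Fin (n + 1) → ℤ) : Fin n → ℤ :=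
  fun j => x (Fin.castSucc j) - x (Fin.last n) * v k j

theorem toReal_project {B : AffineBasis (Fin (n + 1)) ℝ (Fin n → ℝ)}
    {v : Fin (n + 1) → Fin n → ℤ} (hB : ∀ i, B i = toReal (v i))
    {J : Finset (Fin (n + 1))} {k : Fin (n + 1)} (hk : k ∈ J) {x : Fin (n + 1) → ℤ}
    {l : Fin (n + 1) → ℝ} (hx : toReal x = ∑ i ∈ J, l i • toReal (lift (v i))) :
    toReal (project v k x) = (∑ i : J.erase k, l i • edgeBasis B hk i :
      vectorSpan ℝ (simplexFace B J)) := by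
  rw [toReal_eq_sum_lift_iff] at hx
  rw [Submodule.coe_sum]
  simp only [Submodule.coe_smul, coe_edgeBasis]
  rw [Finset.sum_coe_sort (J.erase k) fun i => l i • (B i - B k),
    Finset.sum_erase _ (by rw [sub_self, smul_zero])]
  simp only [smul_sub, Finset.sum_sub_distrib, ← Finset.sum_smul, ← hx.2, hB]
  rw [← hx.1]
  ext j
  simp [toReal, project]

/-- The lattice points of the half-open parallelepiped over a face represent the classes of the
lattice of the face modulo the lattice generated by its edges. -/
theorem card_quotient_eq_card_halfOpenBox {B : AffineBasis (Fin (n + 1)) ℝ (Fin n → ℝ)}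
    {v : Fin (n + 1) → Fin n → ℤ} (hB : ∀ i, B i = toReal (v i))
    {J : Finset (Fin (n + 1))} {k : Fin (n + 1)} (hk : k ∈ J) :
    Nat.card (latticeOf (simplexFace B J) ⧸
      (Submodule.span ℤ (Set.range (edgeBasis B hk))).comap
        (latticeOf (simplexFace B J)).subtype) = Nat.card (halfOpenBox v J) := by
  classical
  set b := edgeBasis B hk with hb
  have hp : ∀ x : halfOpenBox v J, ∃ w : latticeOf (simplexFace B J),
      toReal (project v k x) = (w : vectorSpan ℝ (simplexFace B J)) ∧
      ∃ l : Fin (n + 1) → ℝ, (∀ i ∈ J, 0 ≤ l i ∧ l i < 1) ∧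
        toReal (x : Fin (n + 1) → ℤ) = ∑ i ∈ J, l i • toReal (lift (v i)) ∧
        ∀ i, b.repr w i = l i := by
    rintro ⟨x, l, hl, hx⟩
    refine ⟨⟨_, mem_latticeOf.2 ⟨_, toReal_project hB hk hx⟩⟩, toReal_project hB hk hx,
      l, hl, hx, fun i => ?_⟩
    exact congrFun (b.repr_sum_self fun i => l i) i
  choose w hw l hl hx hr using hp
  have hmem : ∀ y z : latticeOf (simplexFace B J),
      (Submodule.Quotient.mk y : latticeOf (simplexFace B J) ⧸
        (Submodule.span ℤ (Set.range b)).comap (latticeOf (simplexFace B J)).subtype) =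
        Submodule.Quotient.mk z ↔ ∀ i, ∃ a : ℤ, (a : ℝ) = b.repr y i - b.repr z i := by
    intro y z
    rw [Submodule.Quotient.eq, Submodule.mem_comap, Basis.mem_span_iff_repr_mem]
    simp
  refine (Nat.card_congr (Equiv.ofBijective (fun x => Submodule.Quotient.mk (w x))
    ⟨fun x y hxy => ?_, fun q => ?_⟩)).symm
  · have heq : ∀ i, b.repr (w x) i = b.repr (w y) i := by
      intro i
      obtain ⟨a, ha⟩ := (hmem _ _).1 hxy i
      have hi := Finset.mem_of_mem_erase i.2
      have h1 := hl x i hi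
      have h2 := hl y i hi
      rw [hr, hr] at ha ⊢
      -- Two numbers in `[0, 1)` with integral difference coincide.
      have h3 : a < 1 := by exact_mod_cast (by linarith : (a : ℝ) < 1)
      have h4 : -1 < a := by exact_mod_cast (by linarith : (-1 : ℝ) < a)
      have h5 : a = 0 := by omega
      rw [h5, Int.cast_zero] at ha
      linarith
    have hll : ∀ i ∈ J.erase k, l x i = l y i := fun i hi => by
      rw [← hr x ⟨i, hi⟩, ← hr y ⟨i, hi⟩, heq]
    have hlast : ∀ x : halfOpenBox v J,
        ((x : Fin (n + 1) → ℤ) (Fin.last n) : ℝ) = l x k + ∑ i ∈ J.erase k, l x i := fun x => by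
      rw [(toReal_eq_sum_lift_iff.1 (hx x)).2, Finset.add_sum_erase _ _ hk]
    -- The projection forgets the coefficient at `k`; it is recovered modulo `1` from the
    -- integrality of the height, hence exactly.
    have hk' : l x k = l y k := by
      have hX := hlast x
      have hY := hlast y
      rw [Finset.sum_congr rfl hll] at hX
      have h1 := hl x k hk
      have h2 := hl y k hk
      have h3 : (x : Fin (n + 1) → ℤ) (Fin.last n) - (y : Fin (n + 1) → ℤ) (Fin.last n) < 1 := by
        rw [← Int.cast_lt (R := ℝ)]
        push_cast
        linarith
      have h4 : -1 < (x : Fin (n + 1) → ℤ) (Fin.last n) - (y : Fin (n + 1) → ℤ) (Fin.last n) := by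
        rw [← Int.cast_lt (R := ℝ)]
        push_cast
        linarith
      have h5 : (x : Fin (n + 1) → ℤ) (Fin.last n) = (y : Fin (n + 1) → ℤ) (Fin.last n) := by
        omega
      rw [h5] at hX
      linarith
    apply Subtype.ext
    apply toReal_injective
    rw [hx x, hx y]
    refine Finset.sum_congr rfl fun i hi => ?_
    by_cases hik : i = k
    · rw [hik, hk']
    · rw [hll i (Finset.mem_erase.2 ⟨hik, hi⟩)]
  · obtain ⟨z, rfl⟩ := Submodule.Quotient.mk_surjective _ q
    have hfl : (ZSpan.floor b (z : vectorSpan ℝ (simplexFace B J)) :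
        vectorSpan ℝ (simplexFace B J)) ∈ latticeOf (simplexFace B J) :=
      span_edgeBasis_le hB hk (SetLike.coe_mem _)
    obtain ⟨a, ha⟩ := mem_latticeOf.1 (sub_mem z.2 hfl)
    change toReal a = (ZSpan.fract b (z : vectorSpan ℝ (simplexFace B J)) :
      vectorSpan ℝ (simplexFace B J)) at ha
    set S : ℝ := ∑ i, Int.fract (b.repr (z : vectorSpan ℝ (simplexFace B J)) i) with hS
    -- The value at `k` lies in `[0, 1)` and raises the coefficient sum over `J` to the integer
    -- `⌈S⌉`. Values outside `J` play no role.
    let f : Fin (n + 1) → ℝ := fun i => if h : i ∈ J.erase k then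
      Int.fract (b.repr (z : vectorSpan ℝ (simplexFace B J)) ⟨i, h⟩) else ⌈S⌉ - S
    have hfi : ∀ i : J.erase k,
        f i = Int.fract (b.repr (z : vectorSpan ℝ (simplexFace B J)) i) := fun i => dif_pos i.2
    have hfk : f k = ⌈S⌉ - S := dif_neg (Finset.notMem_erase k J)
    have hsumf : ∑ i ∈ J.erase k, f i = S := by
      rw [← Finset.sum_coe_sort (J.erase k) f, hS]
      exact Finset.sum_congr rfl fun i _ => hfi i
    have ha' : toReal a = ∑ i ∈ J.erase k, f i • (B i - B k) := by
      rw [ha, ← b.sum_repr (ZSpan.fract b _), Submodule.coe_sum,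
        ← Finset.sum_coe_sort (J.erase k) fun i => f i • (B i - B k)]
      refine Finset.sum_congr rfl fun i _ => ?_
      rw [ZSpan.repr_fract_apply, Submodule.coe_smul, hb, coe_edgeBasis, hfi]
    -- The lift of `a` to height `⌈S⌉` along `(vₖ, 1)`, so that it projects back to `a`.
    let x : Fin (n + 1) → ℤ := Fin.snoc (α := fun _ => ℤ) (a + ⌈S⌉ • v k) ⌈S⌉
    have hxf : toReal x = ∑ i ∈ J, f i • toReal (lift (v i)) := by
      rw [toReal_eq_sum_lift_iff, ← Finset.add_sum_erase _ _ hk, ← Finset.add_sum_erase _ _ hk,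
        hsumf, hfk]
      constructor
      · have h1 : (toReal fun j => x (Fin.castSucc j)) = toReal a + (⌈S⌉ : ℝ) • toReal (v k) := by
          ext j
          simp [toReal, x]
        rw [h1, ha']
        simp only [smul_sub, Finset.sum_sub_distrib, ← Finset.sum_smul, hsumf, hB]
        module
      · simp [x]
    have hxm : x ∈ halfOpenBox v J := by
      refine ⟨f, fun i hi => ?_, hxf⟩
      by_cases hik : i = k
      · rw [hik, hfk]
        exact ⟨sub_nonneg.2 (Int.le_ceil S), by linarith [Int.ceil_lt_add_one S]⟩
      · have := hfi ⟨i, Finset.mem_erase.2 ⟨hik, hi⟩⟩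
        simp only at this
        rw [this]
        exact ⟨Int.fract_nonneg _, Int.fract_lt_one _⟩
    refine ⟨⟨x, hxm⟩, (hmem _ _).2 fun i => ?_⟩
    have hwz : ((w ⟨x, hxm⟩ : vectorSpan ℝ (simplexFace B J)) : Fin n → ℝ) = toReal a := by
      rw [← hw]
      congr 1
      ext j
      simp [project, x]
    have hwz' : (w ⟨x, hxm⟩ : vectorSpan ℝ (simplexFace B J)) =
        ZSpan.fract b (z : vectorSpan ℝ (simplexFace B J)) := Subtype.ext (hwz.trans ha)
    refine ⟨-⌊b.repr (z : vectorSpan ℝ (simplexFace B J)) i⌋, ?_⟩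
    rw [hwz', ZSpan.repr_fract_apply, Int.fract]
    push_cast
    ring

end LatticePolytope

/-! ### Exchange of summation -/

open LatticePolytope in
theorem proposition3p2 (n : ℕ) (v : Fin (n + 1) → Fin n → ℤ)
    (hv : AffineIndependent ℝ (fun i => LatticePolytope.toReal (v i)))
    (P : Set (Fin n → ℝ))
    (hP : P = convexHull ℝ (Set.range (fun i => LatticePolytope.toReal (v i)))) :
    0 ≤ LatticePolytope.c P ∧
      LatticePolytope.c P =
        ∑ I : Finset (Fin (n + 1)), (Nat.choose I.card n : ℝ) * (LatticePolytope.s v I : ℝ) := by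
  have hc : LatticePolytope.c P =
      ∑ I : Finset (Fin (n + 1)), (Nat.choose I.card n : ℝ) * (LatticePolytope.s v I : ℝ) := by
    classical
    let B : AffineBasis (Fin (n + 1)) ℝ (Fin n → ℝ) := ⟨fun i => toReal (v i), hv, by
      rw [hv.affineSpan_eq_top_iff_card_eq_finrank_add_one]
      simp⟩
    have hB : ∀ i, B i = toReal (v i) := fun i => rfl
    have hvol : ∀ J : Finset (Fin (n + 1)),
        (-1 : ℝ) ^ (n + 1 - J.card) * J.card * normalizedVolume (simplexFace B J) =
        ∑ I : Finset (Fin (n + 1)),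
          (if I ⊆ J then (-1 : ℝ) ^ (n + 1 - J.card) * J.card else 0) * s v I := by
      intro J
      rcases J.eq_empty_or_nonempty with rfl | ⟨k, hk⟩
      -- Both sides vanish through the factor `|J| = 0`.
      · simp
      · rw [normalizedVolume_simplexFace hB hk, card_quotient_eq_card_halfOpenBox hB hk,
          card_halfOpenBox hv J]
        simp only [ite_mul, zero_mul, ← Finset.sum_filter, ← Finset.mul_sum, Nat.cast_sum]
        congr 2
        ext I
        simp
    rw [hP]
    change c (convexHull ℝ (Set.range B)) = _
    rw [c_simplex, Finset.sum_congr rfl fun J _ => hvol J, Finset.sum_comm]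
    refine Finset.sum_congr rfl fun I _ => ?_
    rw [← Finset.sum_mul, sum_superset_neg_one_pow_mul_card]
  exact ⟨hc ▸ Finset.sum_nonneg fun I _ => by positivity, hc⟩
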